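/- Let $G$ be a finite nilpotent group and let $g\in G$. Write $g^G$ for the conjugacy class of $g$ in $G$, $\mathrm{Cl}(G)$ for the set of conjugacy classes of $G$, and $\mathrm{Irr}(G)$ for the set of irreducible complex characters of $G$; a character $\chi\in\mathrm{Irr}(G)$ is called nonlinear if $\chi(1)\neq 1$. If $|g^G|>\frac{|G|}{|\mathrm{Cl}(G)|}$, then $\chi(g)=0$ for more than half of the nonlinear $\chi\in\mathrm{Irr}(G)$. If $|g^G|=\frac{|G|}{|\mathrm{Cl}(G)|}$, then $\chi(g)=0$ for at least half of the nonlinear $\chi\in\mathrm{Irr}(G)$. -/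

import Mathlib

/-- The set `Irr(G)` of irreducible complex characters of `G`: the functions `χ : G → ℂ` that are
characters `g ↦ tr (ρ g)` of irreducible finite-dimensional complex representations `ρ` of `G`.
Every finite-dimensional complex vector space is isomorphic to one in `Type`, so the universe of
`V` is no restriction. -/
def Irr (G : Type*) [Group G] : Set (G → ℂ) :=
  {χ | ∃ (V : Type) (_ : AddCommGroup V) (_ : Module ℂ V) (_ : FiniteDimensional ℂ V)
    (ρ : Representation ℂ G V), ρ.IsIrreducible ∧ ρ.character = χ}

/-- The nonlinear irreducible characters of `G`: those `χ ∈ Irr(G)` whose degree `χ(1)` is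
not `1`. -/
def nonlinearIrr (G : Type*) [Group G] : Set (G → ℂ) :=
  {χ ∈ Irr G | χ 1 ≠ 1}

/-- A finite group has finitely many irreducible characters, so that counting them by
`Set.ncard` is meaningful. -/
theorem Irr_finite (G : Type*) [Group G] [Finite G] : (Irr G).Finite := by
  classical
  cases nonempty_fintype G
  have hG : (Nat.card G : ℂ) ≠ 0 := by exact_mod_cast Nat.card_pos.ne'
  let _ : Invertible (Nat.card G : ℂ) := invertibleOfNonzero hG
  have key : ∀ χ ∈ Irr G, ∀ ψ ∈ Irr G,
      (Nat.card G : ℂ)⁻¹ * ∑ g : G, χ g * ψ g⁻¹ = if χ = ψ then 1 else 0 := by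
    rintro _ ⟨V, _, _, _, ρ, hρ, rfl⟩ _ ⟨W, _, _, _, σ, hσ, rfl⟩
    have h := Representation.char_orthonormal ρ σ
    split_ifs with hc
    · have h' := Representation.char_orthonormal ρ ρ
      rw [if_pos ⟨Representation.Equiv.refl ρ⟩] at h'
      rw [← hc]
      simpa using h'
    · rw [if_neg] at h
      · simpa using h
      · rintro ⟨φ⟩
        exact hc (Representation.char_iso φ).symm
  have hli : LinearIndependent ℂ (fun χ : Irr G => (χ : G → ℂ)) := by
    rw [linearIndependent_iff']
    intro s c hc ψ hψ
    have h1 : ∑ g : G, (∑ χ ∈ s, c χ • (χ : G → ℂ)) g * (ψ : G → ℂ) g⁻¹ = 0 := by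
      rw [hc]; simp
    have h2 : ∑ g : G, (∑ χ ∈ s, c χ • (χ : G → ℂ)) g * (ψ : G → ℂ) g⁻¹
        = ∑ χ ∈ s, c χ * ∑ g : G, (χ : G → ℂ) g * (ψ : G → ℂ) g⁻¹ := by
      simp only [Finset.sum_apply, Pi.smul_apply, smul_eq_mul, Finset.sum_mul, Finset.mul_sum]
      rw [Finset.sum_comm]
      simp only [mul_assoc]
    have h3 : ∀ χ : Irr G, ∑ g : G, (χ : G → ℂ) g * (ψ : G → ℂ) g⁻¹
        = if χ = ψ then (Nat.card G : ℂ) else 0 := by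
      intro χ
      have h := key χ χ.2 ψ ψ.2
      rw [inv_mul_eq_iff_eq_mul₀ hG] at h
      rw [h]
      simp [Subtype.ext_iff]
    rw [h2] at h1
    simp only [h3, mul_ite, mul_zero, Finset.sum_ite_eq', hψ, if_true] at h1
    exact (mul_eq_zero.mp h1).resolve_right hG
  exact Set.finite_coe_iff.mp hli.finite

/-!
Let `χ` be a nonlinear irreducible character with `χ(g) ≠ 0`. The heart of the proof is that the
average of `|χ(g ^ k)|²` over `k ∈ (ℤ/|G|)ˣ` is at least `2`; for a linear character it is `1`.
Since `g ^ k` has a conjugacy class of the same size as `g`, averaging column orthogonality gives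
`|g^G| (2 · #{χ nonlinear, χ(g) ≠ 0} + #{χ linear}) ≤ |G|`, and `|Cl(G)| ≤ |Irr(G)|` finishes.

For the bound `2`, let `ρ` afford `χ`. By nilpotency there are a prime `p` and `p`-elements `h, x`
with `ρ(h)ρ(x) = zρ(x)ρ(h)` for a primitive `p`-th root of unity `z`. Write `|G| = qn` with `q` the
`p`-part, and correspondingly `g = ab`. As `b` has order prime to `p`, it commutes with `h` and
`x`, so taking determinants on the eigenspaces of `ρ(b)` shows that their dimensions are divisible
by `p`. The traces of the powers of `ρ(b)` on the eigenspaces of `ρ(a)` are vectors in the lattice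
of conjugates of `ℤ[η]`, with `η` a primitive `n`-th root of unity, and they sum to `p` times a
lattice vector. By Parseval, the sum of `|χ(g ^ k)|²` is a multiple of a sum of spreads of families
of `p` lattice vectors. A nonzero lattice vector has norm square at least `φ(n)`, by the AM-GM
inequality and the integrality of norms, so a nonconstant family has a large spread; if only one
family is not constant, then its mean lies in the lattice and the bound on its spread doubles.
-/

section Spread

variable {E U : Type*} [NormedAddCommGroup E] [Fintype U]

/-- The spread of a finite family of vectors: `card U` times the sum of the squared distances to
the mean, which is also half the sum of all squared mutual distances (`two_mul_spread`). -/
noncomputable def spread (a : U → E) : ℝ :=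
  Fintype.card U * ∑ u, ‖a u‖ ^ 2 - ‖∑ u, a u‖ ^ 2

variable [InnerProductSpace ℝ E]

theorem two_mul_spread (a : U → E) : 2 * spread a = ∑ u, ∑ v, ‖a u - a v‖ ^ 2 := by
  simp only [norm_sub_sq_real, Finset.sum_add_distrib, Finset.sum_sub_distrib, ← Finset.mul_sum,
    ← inner_sum, ← sum_inner, real_inner_self_eq_norm_sq, Finset.sum_const, Finset.card_univ,
    nsmul_eq_mul, spread]
  ring

theorem spread_nonneg (a : U → E) : 0 ≤ spread a :=
  nonneg_of_mul_nonneg_right (two_mul_spread a ▸ by positivity : 0 ≤ 2 * spread a) two_pos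

theorem spread_sub_const (a : U → E) (b : E) : spread (fun u => a u - b) = spread a :=
  mul_left_cancel₀ two_ne_zero (by simp only [two_mul_spread, sub_sub_sub_cancel_right])

variable {S : AddSubgroup E} {c : ℝ}

theorem card_sub_one_mul_le_spread (hS : ∀ x ∈ S, x ≠ 0 → c ≤ ‖x‖ ^ 2) {a : U → E}
    (ha : ∀ u, a u ∈ S) {u₀ u₁ : U} (h : a u₀ ≠ a u₁) :
    (Fintype.card U - 1) * c ≤ spread a := by
  classical
  have hne : u₀ ≠ u₁ := fun hu => h (congrArg a hu)
  have hpair (u : U) : c ≤ ‖a u - a u₀‖ ^ 2 + ‖a u - a u₁‖ ^ 2 := by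
    rcases ne_or_eq (a u) (a u₀) with hu | hu
    · linarith [hS _ (S.sub_mem (ha u) (ha u₀)) (sub_ne_zero.mpr hu), sq_nonneg ‖a u - a u₁‖]
    · linarith [hS _ (S.sub_mem (ha u) (ha u₁)) (sub_ne_zero.mpr (hu ▸ h)),
        sq_nonneg ‖a u - a u₀‖]
  let row (u : U) : ℝ := ∑ v, ‖a u - a v‖ ^ 2
  have hrow (u : U) : c ≤ row u :=
    calc c ≤ ∑ v ∈ {u₀, u₁}, ‖a u - a v‖ ^ 2 := by rw [Finset.sum_pair hne]; exact hpair u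
      _ ≤ row u := Finset.sum_le_sum_of_subset_of_nonneg (Finset.subset_univ _)
        fun _ _ _ => sq_nonneg _
  have hrows : Fintype.card U * c ≤ row u₀ + row u₁ := by
    simp only [row, ← Finset.sum_add_distrib, norm_sub_rev (a u₀), norm_sub_rev (a u₁)]
    simpa using Finset.card_nsmul_le_sum Finset.univ _ c fun u _ => hpair u
  have hrest : (Fintype.card U - 2) * c ≤ ∑ u ∈ ({u₀, u₁} : Finset U)ᶜ, row u := by
    have hcard := Finset.card_add_card_compl ({u₀, u₁} : Finset U)
    rw [Finset.card_pair hne] at hcard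
    rw [← hcard, Nat.cast_add, Nat.cast_two, add_sub_cancel_left, ← nsmul_eq_mul]
    exact Finset.card_nsmul_le_sum _ _ _ fun u _ => hrow u
  have hsum := two_mul_spread a
  rw [← Finset.sum_add_sum_compl {u₀, u₁}, Finset.sum_pair hne] at hsum
  linarith

theorem two_mul_card_mul_le_spread (hS : ∀ x ∈ S, x ≠ 0 → c ≤ ‖x‖ ^ 2) {a : U → E}
    (ha : ∀ u, a u ∈ S) {u₀ u₁ : U} (h : a u₀ ≠ a u₁) {b : E} (hb : b ∈ S)
    (hab : ∑ u, a u = Fintype.card U • b) :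
    2 * Fintype.card U * c ≤ spread a := by
  classical
  have hsum : ∑ u, (a u - b) = 0 := by simp [hab]
  obtain ⟨v, hv⟩ : ∃ v, a v - b ≠ 0 := by
    by_contra! hc
    exact h ((sub_eq_zero.mp (hc u₀)).trans (sub_eq_zero.mp (hc u₁)).symm)
  obtain ⟨w, hwv, hw⟩ : ∃ w, w ≠ v ∧ a w - b ≠ 0 := by
    by_contra! hc
    exact hv (by rwa [Finset.sum_eq_single v (fun u _ hu => hc u hu) (by simp)] at hsum)
  have htwo : 2 * c ≤ ∑ u, ‖a u - b‖ ^ 2 :=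
    calc 2 * c ≤ ∑ u ∈ {v, w}, ‖a u - b‖ ^ 2 := by
          rw [Finset.sum_pair hwv.symm, two_mul]
          exact add_le_add (hS _ (S.sub_mem (ha v) hb) hv) (hS _ (S.sub_mem (ha w) hb) hw)
      _ ≤ ∑ u, ‖a u - b‖ ^ 2 := Finset.sum_le_sum_of_subset_of_nonneg (Finset.subset_univ _)
          fun _ _ _ => sq_nonneg _
  rw [← spread_sub_const a b, spread, hsum, norm_zero, zero_pow two_ne_zero, sub_zero,
    mul_comm (2 : ℝ), mul_assoc]
  gcongr

theorem two_mul_card_sub_one_mul_le_sum_spread {T : Type*} [Fintype T] (hc : 0 ≤ c)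
    (hS : ∀ x ∈ S, x ≠ 0 → c ≤ ‖x‖ ^ 2) {a : T → U → E} (ha : ∀ t u, a t u ∈ S)
    {t₀ : T} {u₀ u₁ : U} (h : a t₀ u₀ ≠ a t₀ u₁) {b : E} (hb : b ∈ S)
    (hab : ∑ t, ∑ u, a t u = Fintype.card U • b) :
    2 * (Fintype.card U - 1) * c ≤ ∑ t, spread (a t) := by
  classical
  by_cases hconst : ∃ t₁, t₁ ≠ t₀ ∧ ∃ v w, a t₁ v ≠ a t₁ w
  · obtain ⟨t₁, ht, v, w, hvw⟩ := hconst
    calc 2 * (Fintype.card U - 1) * c ≤ ∑ t ∈ {t₀, t₁}, spread (a t) := by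
          rw [Finset.sum_pair ht.symm]
          linarith [card_sub_one_mul_le_spread hS (ha t₀) h,
            card_sub_one_mul_le_spread hS (ha t₁) hvw]
      _ ≤ ∑ t, spread (a t) := Finset.sum_le_sum_of_subset_of_nonneg (Finset.subset_univ _)
        fun _ _ _ => spread_nonneg _
  · -- All other families are constant, so the mean of `a t₀` lies in `S` too.
    push Not at hconst
    have hmean : ∑ u, a t₀ u = Fintype.card U • (b - ∑ t ∈ Finset.univ.erase t₀, a t u₀) := by
      rw [smul_sub, ← hab, Finset.smul_sum, ← Finset.add_sum_erase _ _ (Finset.mem_univ t₀),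
        eq_sub_iff_add_eq]
      congr 1
      refine Finset.sum_congr rfl fun t ht => ?_
      rw [Finset.sum_congr rfl fun u _ => hconst t (Finset.ne_of_mem_erase ht) u u₀,
        Finset.sum_const, Finset.card_univ]
    calc 2 * (Fintype.card U - 1) * c ≤ 2 * Fintype.card U * c := by linarith
      _ ≤ spread (a t₀) := two_mul_card_mul_le_spread hS (ha t₀) h
        (S.sub_mem hb (S.sum_mem fun t _ => ha t u₀)) hmean
      _ ≤ ∑ t, spread (a t) := Finset.single_le_sum (f := fun t => spread (a t))
        (fun t _ => spread_nonneg _) (Finset.mem_univ t₀)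

end Spread

section RootsOfUnity

variable {E : Type*} [NormedAddCommGroup E] [InnerProductSpace ℂ E]

theorem sum_range_conj_pow_mul_pow {z : ℂ} {M : ℕ} (hz : IsPrimitiveRoot z M) {r s : ℕ}
    (hr : r < M) (hs : s < M) :
    ∑ l ∈ Finset.range M, (starRingEnd ℂ) (z ^ (l * r)) * z ^ (l * s) =
      if r = s then (M : ℂ) else 0 := by
  have hM : M ≠ 0 := Nat.ne_zero_of_lt hr
  have hz0 : z ≠ 0 := hz.ne_zero hM
  have hconj : (starRingEnd ℂ) z = z⁻¹ := (Complex.inv_eq_conj (hz.norm'_eq_one hM)).symm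
  set w := z⁻¹ ^ r * z ^ s with hw
  have hterm (l : ℕ) : (starRingEnd ℂ) (z ^ (l * r)) * z ^ (l * s) = w ^ l := by
    rw [map_pow, hconj, hw, mul_pow, ← pow_mul, ← pow_mul, mul_comm l, mul_comm l]
  simp only [hterm]
  split_ifs with h
  · rw [hw, h, ← mul_pow, inv_mul_cancel₀ hz0]
    simp
  · have hw1 : w ≠ 1 := fun hw1 => h <| hz.pow_inj hr hs <| by
      rwa [hw, inv_pow, inv_mul_eq_one₀ (pow_ne_zero _ hz0)] at hw1
    have hwM : w ^ M = 1 := by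
      rw [hw, mul_pow, pow_right_comm, pow_right_comm z, inv_pow z M, hz.pow_eq_one]
      simp
    rw [geom_sum_eq hw1, hwM, sub_self, zero_div]

theorem sum_range_norm_sq_sum_pow_smul {z : ℂ} {M : ℕ} (hz : IsPrimitiveRoot z M) (b : ℕ → E) :
    ∑ l ∈ Finset.range M, ‖∑ r ∈ Finset.range M, z ^ (l * r) • b r‖ ^ 2 =
      M * ∑ r ∈ Finset.range M, ‖b r‖ ^ 2 := by
  apply Complex.ofReal_injective
  push_cast
  simp only [← Complex.coe_algebraMap, ← inner_self_eq_norm_sq_to_K (𝕜 := ℂ), sum_inner, inner_sum,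
    inner_smul_left, inner_smul_right, Finset.mul_sum]
  rw [Finset.sum_comm]
  refine Finset.sum_congr rfl fun r hr => ?_
  rw [Finset.sum_comm]
  calc ∑ s ∈ Finset.range M, ∑ l ∈ Finset.range M, _
      = ∑ s ∈ Finset.range M, (if s = r then (M : ℂ) else 0) * inner ℂ (b s) (b r) := by
        refine Finset.sum_congr rfl fun s hs => ?_
        rw [← sum_range_conj_pow_mul_pow hz (Finset.mem_range.mp hs) (Finset.mem_range.mp hr),
          Finset.sum_mul]
        exact Finset.sum_congr rfl fun l _ => by ring
    _ = M * inner ℂ (b r) (b r) := by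
        simp [Finset.mem_range.mp hr]

@[to_additive sum_zmod_units_val]
theorem prod_zmod_units_val {M : Type*} [CommMonoid M] (n : ℕ) [NeZero n] (f : ℕ → M) :
    ∏ i : (ZMod n)ˣ, f (i : ZMod n).val = ∏ k ∈ Finset.range n with k.Coprime n, f k := by
  refine Finset.prod_bij (fun i _ => (i : ZMod n).val) ?_ ?_ ?_ fun _ _ => rfl
  · intro i _
    exact Finset.mem_filter.mpr
      ⟨Finset.mem_range.mpr (ZMod.val_lt _), ZMod.val_coe_unit_coprime i⟩
  · intro i _ j _ hij
    exact Units.ext (ZMod.val_injective n hij)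
  · intro k hk
    rw [Finset.mem_filter, Finset.mem_range] at hk
    exact ⟨ZMod.unitOfCoprime k hk.2, Finset.mem_univ _, by simp [ZMod.val_natCast_of_lt hk.1]⟩

theorem sum_range_mul {M : Type*} [AddCommMonoid M] (m n : ℕ) (f : ℕ → M) :
    ∑ k ∈ Finset.range (m * n), f k =
      ∑ t ∈ Finset.range n, ∑ u ∈ Finset.range m, f (m * t + u) := by
  induction n with
  | zero => simp
  | succ n ih => rw [mul_add_one, Finset.sum_range_add, ih, Finset.sum_range_succ]

theorem sum_range_pow_succ {M : Type*} [AddCommMonoid M] (p m : ℕ) (f : ℕ → M) :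
    ∑ r ∈ Finset.range (p ^ (m + 1)), f r =
      ∑ t ∈ Finset.range (p ^ m), ∑ u : Fin p, f (p ^ m * u + t) := by
  rw [pow_succ, sum_range_mul, Finset.sum_comm]
  simp only [Finset.sum_range]

variable {p : ℕ} [Fact p.Prime] {m : ℕ}

theorem sum_zmod_units_prime_pow_val {M : Type*} [AddCommGroup M] (f : ℕ → M) :
    ∑ i : (ZMod (p ^ (m + 1)))ˣ, f (i : ZMod (p ^ (m + 1))).val =
      ∑ k ∈ Finset.range (p ^ (m + 1)), f k - ∑ l ∈ Finset.range (p ^ m), f (p * l) := by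
  have hp : p.Prime := Fact.out
  have hcop (k : ℕ) : k.Coprime (p ^ (m + 1)) ↔ ¬ p ∣ k := by
    rw [Nat.coprime_pow_right_iff m.succ_pos, Nat.coprime_comm, hp.coprime_iff_not_dvd]
  have hdvd : ∑ k ∈ Finset.range (p ^ (m + 1)) with p ∣ k, f k =
      ∑ l ∈ Finset.range (p ^ m), f (p * l) := by
    rw [Finset.sum_filter, pow_succ', sum_range_mul]
    refine Finset.sum_congr rfl fun t _ => ?_
    rw [Finset.sum_eq_single_of_mem 0 (Finset.mem_range.mpr hp.pos), add_zero,
      if_pos (dvd_mul_right p t)]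
    intro u hu hu0
    rw [if_neg]
    rw [Nat.dvd_add_right (dvd_mul_right p t)]
    exact fun h => hu0 (Nat.eq_zero_of_dvd_of_lt h (Finset.mem_range.mp hu))
  rw [sum_zmod_units_val, eq_sub_iff_add_eq, ← hdvd, add_comm]
  simp only [hcop]
  exact Finset.sum_filter_add_sum_filter_not _ _ _

-- Parseval at level `p ^ (m + 1)` computes the sum over all exponents, and at level `p ^ m` the
-- sum over the multiples of `p`.
theorem sum_zmod_units_norm_sq_sum_pow_smul {ω : ℂ} (hω : IsPrimitiveRoot ω (p ^ (m + 1)))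
    (b : ℕ → E) :
    ∑ i : (ZMod (p ^ (m + 1)))ˣ,
        ‖∑ r ∈ Finset.range (p ^ (m + 1)), ω ^ ((i : ZMod (p ^ (m + 1))).val * r) • b r‖ ^ 2 =
      p ^ m * ∑ t : Fin (p ^ m), spread fun u : Fin p => b (p ^ m * u + t) := by
  have hωp : IsPrimitiveRoot (ω ^ p) (p ^ m) :=
    hω.pow (NeZero.pos _) (pow_succ' p m)
  have hmul (l : ℕ) : ∑ r ∈ Finset.range (p ^ (m + 1)), ω ^ (p * l * r) • b r =
      ∑ t ∈ Finset.range (p ^ m), (ω ^ p) ^ (l * t) • ∑ u : Fin p, b (p ^ m * u + t) := by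
    rw [sum_range_pow_succ]
    refine Finset.sum_congr rfl fun t _ => ?_
    rw [Finset.smul_sum]
    refine Finset.sum_congr rfl fun u _ => ?_
    have hexp : p * l * (p ^ m * u + t) = p ^ (m + 1) * (l * u) + p * (l * t) := by ring
    rw [hexp, pow_add, pow_mul, hω.pow_eq_one, one_pow, one_mul, pow_mul]
  rw [sum_zmod_units_prime_pow_val fun k =>
    ‖∑ r ∈ Finset.range (p ^ (m + 1)), ω ^ (k * r) • b r‖ ^ 2]
  simp only [hmul]
  rw [sum_range_norm_sq_sum_pow_smul hω, sum_range_norm_sq_sum_pow_smul hωp, sum_range_pow_succ,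
    Finset.sum_range, Finset.sum_range]
  simp only [spread, Fintype.card_fin, Finset.sum_sub_distrib, ← Finset.mul_sum]
  push_cast
  ring

theorem two_mul_totient_prime_pow_mul_le_sum_norm_sq {S : AddSubgroup E} {c : ℝ} (hc : 0 ≤ c)
    (hS : ∀ x ∈ S, x ≠ 0 → c ≤ ‖x‖ ^ 2) {ω : ℂ} (hω : IsPrimitiveRoot ω (p ^ (m + 1)))
    {b : ℕ → E} (hb : ∀ r, b r ∈ S) {y : E} (hy : y ∈ S)
    (hby : ∑ r ∈ Finset.range (p ^ (m + 1)), b r = p • y) {i₀ : (ZMod (p ^ (m + 1)))ˣ}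
    (h0 : ∑ r ∈ Finset.range (p ^ (m + 1)), ω ^ ((i₀ : ZMod (p ^ (m + 1))).val * r) • b r ≠ 0) :
    2 * (p ^ (m + 1)).totient * c ≤ ∑ i : (ZMod (p ^ (m + 1)))ˣ,
        ‖∑ r ∈ Finset.range (p ^ (m + 1)), ω ^ ((i : ZMod (p ^ (m + 1))).val * r) • b r‖ ^ 2 := by
  have hp : p.Prime := Fact.out
  let _ : InnerProductSpace ℝ E := InnerProductSpace.complexToReal
  have hsum := sum_zmod_units_norm_sq_sum_pow_smul hω b
  obtain ⟨t, u, v, huv⟩ : ∃ (t : Fin (p ^ m)) (u v : Fin p),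
      b (p ^ m * u + t) ≠ b (p ^ m * v + t) := by
    by_contra! hconst
    have hspread (t : Fin (p ^ m)) : spread (fun u : Fin p => b (p ^ m * u + t)) = 0 := by
      have := two_mul_spread fun u : Fin p => b (p ^ m * u + t)
      simpa [hconst t _ 0] using this
    rw [Finset.sum_eq_zero fun t _ => hspread t, mul_zero,
      Finset.sum_eq_zero_iff_of_nonneg fun _ _ => sq_nonneg _] at hsum
    exact h0 (norm_eq_zero.mp (pow_eq_zero_iff two_ne_zero |>.mp (hsum i₀ (Finset.mem_univ _))))
  have hspreads : 2 * ((p : ℝ) - 1) * c ≤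
      ∑ t : Fin (p ^ m), spread fun u : Fin p => b (p ^ m * u + t) := by
    have := two_mul_card_sub_one_mul_le_sum_spread (U := Fin p) hc hS
      (a := fun (t : Fin (p ^ m)) u => b (p ^ m * u + t)) (fun t u => hb _) huv hy (by
        rw [Fintype.card_fin, ← hby, sum_range_pow_succ, Finset.sum_range])
    rwa [Fintype.card_fin] at this
  rw [hsum, Nat.totient_prime_pow_succ hp, Nat.cast_mul, Nat.cast_pred hp.pos, Nat.cast_pow]
  calc 2 * ((p : ℝ) ^ m * (p - 1)) * c = p ^ m * (2 * (p - 1) * c) := by ring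
    _ ≤ _ := by gcongr

end RootsOfUnity

section ConjugateLattice

theorem card_le_sum_of_one_le_prod {ι : Type*} [Fintype ι] {x : ι → ℝ} (hx : ∀ i, 0 ≤ x i)
    (h : 1 ≤ ∏ i, x i) : (Fintype.card ι : ℝ) ≤ ∑ i, x i := by
  cases isEmpty_or_nonempty ι
  · simp
  have hpos : (0 : ℝ) < Fintype.card ι := by exact_mod_cast Fintype.card_pos
  have hmean := Real.geom_mean_le_arith_mean Finset.univ (fun _ => 1) x
    (fun _ _ => zero_le_one) (by simpa using hpos) fun i _ => hx i
  simp only [Real.rpow_one, one_mul, Finset.sum_const, Finset.card_univ, nsmul_eq_mul,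
    mul_one] at hmean
  exact (one_le_div₀ hpos).mp ((Real.one_le_rpow h (inv_nonneg.mpr hpos.le)).trans hmean)

open Polynomial in
theorem exists_prod_aroots_aeval_eq_algebraMap {R K : Type*} [CommRing R] [Field K]
    [IsAlgClosed K] [Algebra R K] {f : R[X]} (hf : f.Monic) (P : R[X]) :
    ∃ r : R, ((f.aroots K).map fun x => aeval x P).prod = algebraMap R K r := by
  refine ⟨f.resultant P (f.map (algebraMap R K)).natDegree P.natDegree, ?_⟩
  have h := resultant_eq_prod_eval (f.map (algebraMap R K)) (P.map (algebraMap R K)) P.natDegree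
    natDegree_map_le (IsAlgClosed.splits _)
  rw [resultant_map_map, hf.map (algebraMap R K), one_pow, one_mul] at h
  rw [h]
  simp only [eval_map_algebraMap, aroots]

variable {n : ℕ} {η : ℂ}

theorem prod_zmod_units_pow_val [NeZero n] (hη : IsPrimitiveRoot η n) (f : ℂ → ℂ) :
    ∏ j : (ZMod n)ˣ, f (η ^ (j : ZMod n).val) = ∏ ξ ∈ primitiveRoots n ℂ, f ξ := by
  rw [prod_zmod_units_val n fun k => f (η ^ k)]
  refine Finset.prod_bij (fun k _ => η ^ k) ?_ ?_ ?_ fun _ _ => rfl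
  · intro k hk
    exact (mem_primitiveRoots (NeZero.pos n)).mpr
      (hη.pow_of_coprime k (Finset.mem_filter.mp hk).2)
  · intro k hk l hl hkl
    simp only [Finset.mem_filter, Finset.mem_range] at hk hl
    exact hη.pow_inj hk.1 hl.1 hkl
  · intro ξ hξ
    obtain ⟨k, hk, hcop, rfl⟩ :=
      hη.isPrimitiveRoot_iff.mp ((mem_primitiveRoots (NeZero.pos n)).mp hξ)
    exact ⟨k, Finset.mem_filter.mpr ⟨Finset.mem_range.mpr hk, hcop⟩, rfl⟩

theorem exists_prod_zmod_units_aeval_eq_intCast [NeZero n] (hη : IsPrimitiveRoot η n)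
    (P : Polynomial ℤ) :
    ∃ k : ℤ, ∏ j : (ZMod n)ˣ, Polynomial.aeval (η ^ (j : ZMod n).val) P = k := by
  obtain ⟨k, hk⟩ :=
    exists_prod_aroots_aeval_eq_algebraMap (K := ℂ) (Polynomial.cyclotomic.monic n ℤ) P
  refine ⟨k, ?_⟩
  rw [prod_zmod_units_pow_val hη fun ξ => Polynomial.aeval ξ P, ← eq_intCast (algebraMap ℤ ℂ),
    ← hk, Polynomial.aroots, Polynomial.map_cyclotomic, Finset.prod,
    ← Polynomial.cyclotomic.roots_eq_primitiveRoots_val]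

/-- For a primitive `n`-th root of unity `η`, the ring `ℤ[η]` embedded in the Euclidean space
indexed by the Galois group `(ℤ/n)ˣ`, each element being sent to the family of its conjugates. -/
def conjugateLattice (n : ℕ) (η : ℂ) : AddSubgroup (EuclideanSpace ℂ (ZMod n)ˣ) :=
  (Algebra.adjoin ℤ {fun j : (ZMod n)ˣ => η ^ (j : ZMod n).val}).toSubring.toAddSubgroup.comap
    (WithLp.addEquiv 2 ((ZMod n)ˣ → ℂ)).toAddMonoidHom

theorem mem_conjugateLattice {x : EuclideanSpace ℂ (ZMod n)ˣ} :
    x ∈ conjugateLattice n η ↔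
      x.ofLp ∈ Algebra.adjoin ℤ {fun j : (ZMod n)ˣ => η ^ (j : ZMod n).val} :=
  Iff.rfl

theorem mem_conjugateLattice_iff_exists_aeval {x : EuclideanSpace ℂ (ZMod n)ˣ} :
    x ∈ conjugateLattice n η ↔
      ∃ P : Polynomial ℤ, ∀ j : (ZMod n)ˣ, Polynomial.aeval (η ^ (j : ZMod n).val) P = x j := by
  rw [mem_conjugateLattice, Algebra.adjoin_singleton_eq_range_aeval, AlgHom.mem_range]
  refine exists_congr fun P => funext_iff.trans (forall_congr' fun j => ?_)
  rw [Polynomial.aeval_pi_apply₂]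

theorem toLp_sum_mem_conjugateLattice {ι : Type*} (s : Finset ι) (d e : ι → ℕ) :
    WithLp.toLp 2 (fun j : (ZMod n)ˣ => ∑ i ∈ s, (d i : ℂ) * η ^ ((j : ZMod n).val * e i)) ∈
      conjugateLattice n η :=
  mem_conjugateLattice_iff_exists_aeval.mpr
    ⟨∑ i ∈ s, (d i : Polynomial ℤ) * Polynomial.X ^ e i, fun j => by simp [pow_mul]⟩

theorem totient_le_norm_sq_of_mem_conjugateLattice [NeZero n] (hη : IsPrimitiveRoot η n)
    {x : EuclideanSpace ℂ (ZMod n)ˣ} (hx : x ∈ conjugateLattice n η) (h0 : x ≠ 0) :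
    (n.totient : ℝ) ≤ ‖x‖ ^ 2 := by
  obtain ⟨P, hP⟩ := mem_conjugateLattice_iff_exists_aeval.mp hx
  have hzero (j : (ZMod n)ˣ) : x j = 0 ↔ minpoly ℤ η ∣ P := by
    have hj := ZMod.val_coe_unit_coprime j
    rw [← hP, hη.minpoly_eq_pow_coprime hj]
    exact minpoly.isIntegrallyClosed_dvd_iff ((hη.pow_of_coprime _ hj).isIntegral (NeZero.pos n)) P
  have hne (j : (ZMod n)ˣ) : x j ≠ 0 := fun hj =>
    h0 (PiLp.ext fun i => (hzero i).mpr ((hzero j).mp hj))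
  obtain ⟨k, hk⟩ := exists_prod_zmod_units_aeval_eq_intCast hη P
  simp only [hP] at hk
  have hk0 : k ≠ 0 := by
    rintro rfl
    exact Finset.prod_ne_zero_iff.mpr (fun j _ => hne j) (hk.trans Int.cast_zero)
  have hk1 : (1 : ℝ) ≤ |(k : ℝ)| := by exact_mod_cast Int.one_le_abs hk0
  rw [← ZMod.card_units_eq_totient, EuclideanSpace.norm_sq_eq]
  refine card_le_sum_of_one_le_prod (fun j => sq_nonneg _) ?_
  rw [Finset.prod_pow, ← norm_prod, hk, Complex.norm_intCast]
  exact one_le_pow₀ hk1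

end ConjugateLattice

section TraceDecomposition

variable {K V : Type*} [Field K] [AddCommGroup V] [Module K V]

theorem dvd_finrank_of_mul_eq_smul_mul {S T : Module.End K V} (hS : IsUnit S) (hT : IsUnit T)
    {z : K} {p : ℕ} (hz : IsPrimitiveRoot z p) (h : S * T = z • (T * S)) :
    p ∣ Module.finrank K V := by
  have hdet : LinearMap.det S * LinearMap.det T =
      z ^ Module.finrank K V * (LinearMap.det S * LinearMap.det T) := by
    rw [mul_comm (LinearMap.det S), ← map_mul, ← LinearMap.det_smul, ← h, map_mul, mul_comm,
      map_mul]
  have hne : LinearMap.det S * LinearMap.det T ≠ 0 :=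
    mul_ne_zero (hS.map LinearMap.det).ne_zero (hT.map LinearMap.det).ne_zero
  exact hz.dvd_of_pow_eq_one _ ((mul_eq_right₀ hne).mp hdet.symm)

theorem mapsTo_eigenspace_of_commute {S T : Module.End K V} (h : Commute T S) (μ : K) :
    ∀ v ∈ T.eigenspace μ, S v ∈ T.eigenspace μ :=
  Module.End.mapsTo_genEigenspace_of_comm h μ 1

variable [IsAlgClosed K] [FiniteDimensional K V] {N : ℕ} [NeZero N] {ζ : K}
  {S T : Module.End K V}

open Module.End

theorem isInternal_eigenspace_pow (hζ : IsPrimitiveRoot ζ N) (hT : T ^ N = 1) :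
    DirectSum.IsInternal fun i : Fin N => T.eigenspace (ζ ^ (i : ℕ)) := by
  rw [DirectSum.isInternal_submodule_iff_iSupIndep_and_iSup_eq_top]
  refine ⟨T.eigenspaces_iSupIndep.comp fun i j hij => Fin.ext (hζ.pow_inj i.2 j.2 hij), ?_⟩
  have hss : T.IsSemisimple :=
    isSemisimple_of_squarefree_aeval_eq_zero (p := Polynomial.X ^ N - 1)
      (Polynomial.separable_X_pow_sub_C 1 hζ.neZero'.ne one_ne_zero).squarefree (by simp [hT])
  rw [eq_top_iff, ← hss.iSup_eigenspace_eq_top, iSup_le_iff]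
  intro μ
  by_cases hμ : T.eigenspace μ = ⊥
  · exact hμ ▸ bot_le
  obtain ⟨v, hv⟩ := (hasEigenvalue_iff.mpr hμ).exists_hasEigenvector
  have hμN : μ ^ N = 1 := smul_left_injective K hv.2 <| by
    simpa [hT] using (hv.pow_apply N).symm
  obtain ⟨i, hi, rfl⟩ := hζ.eq_pow_of_pow_eq_one hμN
  exact le_iSup (fun i : Fin N => T.eigenspace (ζ ^ (i : ℕ))) ⟨i, hi⟩

theorem trace_mul_pow_eq_sum (hζ : IsPrimitiveRoot ζ N) (hT : T ^ N = 1) (h : Commute T S)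
    (k : ℕ) :
    LinearMap.trace K V (S * T ^ k) = ∑ i ∈ Finset.range N, ζ ^ (k * i) *
      LinearMap.trace K (T.eigenspace (ζ ^ i))
        (S.restrict (mapsTo_eigenspace_of_commute h (ζ ^ i))) := by
  have hcomm : Commute T (S * T ^ k) := h.mul_right (Commute.self_pow T k)
  rw [LinearMap.trace_eq_sum_trace_restrict (isInternal_eigenspace_pow hζ hT)
    fun i => mapsTo_eigenspace_of_commute hcomm (ζ ^ (i : ℕ)), Finset.sum_range]
  refine Finset.sum_congr rfl fun i _ => ?_
  have hpow (v : T.eigenspace (ζ ^ (i : ℕ))) : (T ^ k) (v : V) = ζ ^ (k * i) • (v : V) := by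
    by_cases hv0 : (v : V) = 0
    · simp [hv0]
    · rw [HasEigenvector.pow_apply ⟨v.2, hv0⟩, ← pow_mul, mul_comm]
  have hrestrict : (S * T ^ k).restrict (mapsTo_eigenspace_of_commute hcomm (ζ ^ (i : ℕ))) =
      ζ ^ (k * i) • S.restrict (mapsTo_eigenspace_of_commute h (ζ ^ (i : ℕ))) := by
    ext v
    simp [LinearMap.restrict_apply, hpow]
  rw [hrestrict, map_smul, smul_eq_mul]

theorem trace_pow_eq_sum (hζ : IsPrimitiveRoot ζ N) (hT : T ^ N = 1) (k : ℕ) :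
    LinearMap.trace K V (T ^ k) =
      ∑ i ∈ Finset.range N, Module.finrank K (T.eigenspace (ζ ^ i)) * ζ ^ (k * i) := by
  rw [← one_mul (T ^ k), trace_mul_pow_eq_sum hζ hT (Commute.one_right T) k]
  refine Finset.sum_congr rfl fun i _ => ?_
  rw [mul_comm, ← LinearMap.trace_one]
  rfl

end TraceDecomposition

section ComplexTrace

variable {V : Type*} [AddCommGroup V] [Module ℂ V] [FiniteDimensional ℂ V] {T : Module.End ℂ V}
  {n : ℕ}

theorem toLp_trace_pow_mul_pow_eq_sum {S : Module.End ℂ V} {N : ℕ} [NeZero N] {ω : ℂ}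
    (hω : IsPrimitiveRoot ω N) (hT : T ^ N = 1) (h : Commute T S) (k : ℕ) :
    WithLp.toLp 2
        (fun j : (ZMod n)ˣ => LinearMap.trace ℂ V (S ^ (j : ZMod n).val * T ^ k)) =
      ∑ r ∈ Finset.range N, ω ^ (k * r) • WithLp.toLp 2 fun j : (ZMod n)ˣ =>
        LinearMap.trace ℂ (T.eigenspace (ω ^ r))
          (S.restrict (mapsTo_eigenspace_of_commute h (ω ^ r)) ^ (j : ZMod n).val) := by
  ext j
  rw [WithLp.ofLp_sum, Finset.sum_apply]
  refine (trace_mul_pow_eq_sum hω hT (h.pow_right _) k).trans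
    (Finset.sum_congr rfl fun r _ => ?_)
  rw [WithLp.ofLp_smul, Pi.smul_apply, smul_eq_mul]
  dsimp only
  rw [Module.End.pow_restrict]

variable [NeZero n]

theorem trace_eq_conj_trace_of_mul_eq_one {T' : Module.End ℂ V} (hT : T ^ n = 1)
    (hTT' : T * T' = 1) :
    LinearMap.trace ℂ V T' = (starRingEnd ℂ) (LinearMap.trace ℂ V T) := by
  have hζ := Complex.isPrimitiveRoot_exp n (NeZero.ne n)
  set ζ := Complex.exp (2 * Real.pi * Complex.I / n)
  obtain ⟨k, rfl⟩ : ∃ k, n = k + 1 := Nat.exists_eq_succ_of_ne_zero (NeZero.ne n)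
  have hT' : T' = T ^ k := by
    rw [← mul_one (T ^ k), ← hTT', ← mul_assoc, ← pow_succ, hT, one_mul]
  have hconj : (starRingEnd ℂ) ζ = ζ ^ k := by
    rw [← Complex.inv_eq_conj (hζ.norm'_eq_one k.succ_ne_zero)]
    exact inv_eq_of_mul_eq_one_right (by rw [← pow_succ', hζ.pow_eq_one])
  rw [hT', ← pow_one T, ← pow_mul, one_mul, trace_pow_eq_sum hζ hT, trace_pow_eq_sum hζ hT, map_sum]
  refine Finset.sum_congr rfl fun i _ => ?_
  rw [map_mul, map_pow, hconj, Complex.conj_natCast, ← pow_mul, one_mul]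

variable {η : ℂ}

theorem toLp_trace_pow_mem_conjugateLattice (hη : IsPrimitiveRoot η n) (hT : T ^ n = 1) :
    WithLp.toLp 2 (fun j : (ZMod n)ˣ => LinearMap.trace ℂ V (T ^ (j : ZMod n).val)) ∈
      conjugateLattice n η := by
  simp only [trace_pow_eq_sum hη hT]
  exact toLp_sum_mem_conjugateLattice _ _ _

theorem exists_toLp_trace_pow_eq_nsmul {p : ℕ} (hη : IsPrimitiveRoot η n) (hT : T ^ n = 1)
    (hp : ∀ μ, p ∣ Module.finrank ℂ (T.eigenspace μ)) :
    ∃ y ∈ conjugateLattice n η,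
      WithLp.toLp 2 (fun j : (ZMod n)ˣ => LinearMap.trace ℂ V (T ^ (j : ZMod n).val)) =
        p • y := by
  choose d hd using hp
  refine ⟨_, toLp_sum_mem_conjugateLattice (Finset.range n) (fun i => d (η ^ i)) id, ?_⟩
  ext j
  simp [trace_pow_eq_sum hη hT, hd, Finset.mul_sum, mul_assoc]

theorem two_mul_totient_mul_totient_le_sum_norm_sq_trace {S : Module.End ℂ V} {p m : ℕ}
    [Fact p.Prime] (h : Commute T S) (hT : T ^ p ^ (m + 1) = 1) (hS : S ^ n = 1)
    (hp : ∀ μ, p ∣ Module.finrank ℂ (S.eigenspace μ)) {i₀ : (ZMod (p ^ (m + 1)))ˣ}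
    {j₀ : (ZMod n)ˣ}
    (h0 : LinearMap.trace ℂ V
      (S ^ (j₀ : ZMod n).val * T ^ (i₀ : ZMod (p ^ (m + 1))).val) ≠ 0) :
    2 * (p ^ (m + 1)).totient * (n.totient : ℝ) ≤
      ∑ i : (ZMod (p ^ (m + 1)))ˣ, ∑ j : (ZMod n)ˣ,
        ‖LinearMap.trace ℂ V
          (S ^ (j : ZMod n).val * T ^ (i : ZMod (p ^ (m + 1))).val)‖ ^ 2 := by
  have hω := Complex.isPrimitiveRoot_exp (p ^ (m + 1)) (NeZero.ne _)
  have hη := Complex.isPrimitiveRoot_exp n (NeZero.ne n)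
  set ω := Complex.exp (2 * Real.pi * Complex.I / (p ^ (m + 1) : ℕ))
  have hsum := toLp_trace_pow_mul_pow_eq_sum (n := n) hω hT h
  have hrestrict (r : ℕ) : S.restrict (mapsTo_eigenspace_of_commute h (ω ^ r)) ^ n = 1 := by
    rw [Module.End.pow_restrict]
    ext v
    simp [LinearMap.restrict_apply, hS]
  obtain ⟨y, hy, hSy⟩ := exists_toLp_trace_pow_eq_nsmul hη hS hp
  have hle := two_mul_totient_prime_pow_mul_le_sum_norm_sq (Nat.cast_nonneg n.totient)
    (fun x hx => totient_le_norm_sq_of_mem_conjugateLattice hη hx) hω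
    (fun r => toLp_trace_pow_mem_conjugateLattice hη (hrestrict r)) hy
    (by simpa [hSy] using (hsum 0).symm)
    (i₀ := i₀) (by
      rw [← hsum]
      exact fun hzero => h0 (congrFun (congrArg WithLp.ofLp hzero) j₀))
  simpa only [← hsum, EuclideanSpace.norm_sq_eq] using hle

end ComplexTrace

section Schur

variable {k G V : Type*} [Field k] [Monoid G] [AddCommGroup V] [Module k V]

theorem exists_eq_smul_one_of_isIrreducible [IsAlgClosed k] [FiniteDimensional k V]
    {ρ : Representation k G V} (hρ : ρ.IsIrreducible) {T : Module.End k V}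
    (hT : ∀ g, T * ρ g = ρ g * T) : ∃ c : k, T = c • 1 := by
  let f : ρ.IntertwiningMap ρ := ⟨T, hT⟩
  obtain ⟨c, hc⟩ :=
    (Representation.IsIrreducible.algebraMap_intertwiningMap_bijective_of_isAlgClosed (ρ := ρ)).2 f
  exact ⟨c, (congrArg Representation.IntertwiningMap.toLinearMap hc).symm⟩

theorem isIrreducible_of_equiv {W : Type*} [AddCommGroup W] [Module k W]
    {ρ : Representation k G V} {σ : Representation k G W} (e : ρ.Equiv σ)
    (hρ : ρ.IsIrreducible) : σ.IsIrreducible := by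
  rw [Representation.irreducible_iff_isSimpleModule_asModule] at hρ ⊢
  exact .congr (LinearEquiv.ofBijective
    (Representation.IntertwiningMap.equivLinearMapAsModule ρ σ e.toIntertwiningMap)
    e.bijective).symm

open scoped MonoidAlgebra

theorem isIrreducible_ofModule' {M : Type*} [AddCommGroup M] [Module k M] [Module k[G] M]
    [IsScalarTower k k[G] M] [IsSimpleModule k[G] M] :
    (Representation.ofModule' (k := k) (G := G) M).IsIrreducible := by
  rw [Representation.irreducible_iff_isSimpleModule_asModule]
  let e : (Representation.ofModule' (k := k) (G := G) M).asModule ≃ₗ[k[G]] M :=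
    { (Representation.ofModule' M).asModuleEquiv with
      map_smul' := fun r v => (Representation.asModuleEquiv_map_smul _ r v).trans <|
        LinearMap.congr_fun (AlgHom.congr_fun
          ((MonoidAlgebra.lift k (Module.End k M) G).apply_symm_apply _) r) v }
  exact .congr e

end Schur

section IrreducibleCharacters

variable {G : Type*} [Group G]

theorem Irr_apply_conj {χ : G → ℂ} (hχ : χ ∈ Irr G) (g x : G) : χ (g * x * g⁻¹) = χ x := by
  obtain ⟨V, _, _, _, ρ, -, rfl⟩ := hχ
  exact ρ.char_conj x g

theorem Irr_apply_inv [Finite G] {χ : G → ℂ} (hχ : χ ∈ Irr G) (g : G) :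
    χ g⁻¹ = (starRingEnd ℂ) (χ g) := by
  obtain ⟨V, _, _, _, ρ, -, rfl⟩ := hχ
  exact trace_eq_conj_trace_of_mul_eq_one (n := Nat.card G)
    (by rw [← map_pow, pow_card_eq_one', map_one])
    (by rw [← map_mul, mul_inv_cancel, map_one])

theorem character_mem_Irr {V : Type*} [AddCommGroup V] [Module ℂ V]
    [FiniteDimensional ℂ V] {ρ : Representation ℂ G V} (hρ : ρ.IsIrreducible) :
    ρ.character ∈ Irr G := by
  let e : V ≃ₗ[ℂ] (Fin (Module.finrank ℂ V) → ℂ) := LinearEquiv.ofFinrankEq _ _ (by simp)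
  let σ : Representation ℂ G (Fin (Module.finrank ℂ V) → ℂ) :=
    (e.conjAlgEquiv ℂ : _ →* _).comp ρ
  have E : ρ.Equiv σ := .mk e fun g => by ext; simp [σ, LinearEquiv.conjAlgEquiv_apply]
  exact ⟨_, _, _, inferInstance, σ, isIrreducible_of_equiv E hρ, (Representation.char_iso E).symm⟩

section ClassFunctions

variable [Fintype G] {f : G → ℂ}

theorem sum_smul_eq_zero_of_isIrreducible (hf : ∀ g x, f (g * x * g⁻¹) = f x) {V : Type*}
    [AddCommGroup V] [Module ℂ V] [FiniteDimensional ℂ V] {ρ : Representation ℂ G V}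
    (hρ : ρ.IsIrreducible) (h : ∑ x, f x * ρ.character x⁻¹ = 0) : ∑ x, f x • ρ x⁻¹ = 0 := by
  have hcomm (g : G) : (∑ x, f x • ρ x⁻¹) * ρ g = ρ g * ∑ x, f x • ρ x⁻¹ := by
    rw [Finset.sum_mul, Finset.mul_sum, ← (MulAut.conj g).toEquiv.sum_comp]
    refine Finset.sum_congr rfl fun x _ => ?_
    simp only [MulEquiv.toEquiv_eq_coe, EquivLike.coe_coe, MulAut.conj_apply, hf,
      smul_mul_assoc, mul_smul_comm, ← map_mul]
    congr 2
    group
  obtain ⟨c, hc⟩ := exists_eq_smul_one_of_isIrreducible hρ hcomm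
  have htrace : c * Module.finrank ℂ V = 0 := by
    rw [← h, ← LinearMap.trace_one ℂ V, ← smul_eq_mul, ← map_smul, ← hc, map_sum]
    simp only [map_smul, smul_eq_mul, Representation.character]
  rcases mul_eq_zero.mp htrace with h0 | h0
  · rw [hc, h0, zero_smul]
  · have : Subsingleton V := Module.finrank_zero_iff.mp (by exact_mod_cast h0)
    exact Subsingleton.elim _ _

open scoped MonoidAlgebra

theorem sum_single_smul_eq_zero_of_isSimpleModule (hf : ∀ g x, f (g * x * g⁻¹) = f x)
    (h : ∀ χ ∈ Irr G, ∑ x, f x * χ x⁻¹ = 0) {M : Type*} [AddCommGroup M] [Module ℂ M]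
    [Module ℂ[G] M] [IsScalarTower ℂ ℂ[G] M] [IsSimpleModule ℂ[G] M] (v : M) :
    (∑ x, MonoidAlgebra.single x⁻¹ (f x) : ℂ[G]) • v = 0 := by
  have hρ := isIrreducible_ofModule' (k := ℂ) (G := G) (M := M)
  have : Module.Finite ℂ M := Module.Finite.trans ℂ[G] M
  simpa [Representation.ofModule', Finset.sum_smul, ← smul_assoc] using
    LinearMap.congr_fun (sum_smul_eq_zero_of_isIrreducible hf hρ (h _ (character_mem_Irr hρ))) v

-- An element of `ℂ[G]` killing every simple module lies in the Jacobson radical, which is zero.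
theorem eq_zero_of_sum_mul_Irr_inv_eq_zero (hf : ∀ g x, f (g * x * g⁻¹) = f x)
    (h : ∀ χ ∈ Irr G, ∑ x, f x * χ x⁻¹ = 0) : f = 0 := by
  classical
  have hzero : (∑ x, MonoidAlgebra.single x⁻¹ (f x) : ℂ[G]) = 0 := by
    rw [← Submodule.mem_bot ℂ[G], ← IsSemisimpleRing.jacobson_eq_bot,
      Ring.jacobson_eq_sInf_isMaximal, Ideal.mem_sInf]
    intro m hm
    have : IsSimpleModule ℂ[G] (ℂ[G] ⧸ m) :=
      isSimpleModule_iff_isCoatom.mpr (Ideal.isMaximal_def.mp hm)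
    rw [← Submodule.Quotient.mk_eq_zero, ← mul_one (∑ x, _), ← smul_eq_mul,
      Submodule.Quotient.mk_smul]
    exact sum_single_smul_eq_zero_of_isSimpleModule hf h _
  ext y
  simpa [Finsupp.single_apply, Finsupp.finsetSum_apply] using
    congrArg (fun a : ℂ[G] => a.coeff y⁻¹) hzero

theorem sum_Irr_mul_Irr_inv {χ ψ : G → ℂ} (hχ : χ ∈ Irr G) (hψ : ψ ∈ Irr G)
    [Decidable (χ = ψ)] : ∑ g, χ g * ψ g⁻¹ = if χ = ψ then (Nat.card G : ℂ) else 0 := by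
  have hG : (Nat.card G : ℂ) ≠ 0 := by exact_mod_cast Nat.card_pos.ne'
  let _ : Invertible (Nat.card G : ℂ) := invertibleOfNonzero hG
  obtain ⟨V, _, _, _, ρ, hρ, rfl⟩ := hχ
  obtain ⟨W, _, _, _, σ, hσ, rfl⟩ := hψ
  split_ifs with heq
  · have h := Representation.char_orthonormal ρ ρ
    rw [if_pos ⟨Representation.Equiv.refl ρ⟩, inv_mul_eq_iff_eq_mul₀ hG, mul_one] at h
    rw [← heq, h]
  · have h := Representation.char_orthonormal ρ σ
    rwa [if_neg fun ⟨φ⟩ => heq (Representation.char_iso φ).symm, inv_mul_eq_iff_eq_mul₀ hG,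
      mul_zero] at h

theorem card_mul_eq_sum_Irr (hf : ∀ g x, f (g * x * g⁻¹) = f x) (y : G) :
    Nat.card G * f y = ∑ χ ∈ (Irr_finite G).toFinset, (∑ x, f x * χ x⁻¹) * χ y := by
  classical
  rw [← sub_eq_zero]
  refine congrFun (eq_zero_of_sum_mul_Irr_inv_eq_zero (f := fun y => Nat.card G * f y -
    ∑ χ ∈ (Irr_finite G).toFinset, (∑ x, f x * χ x⁻¹) * χ y) (fun g x => ?_) fun ψ hψ => ?_) y
  · rw [hf]
    congr 1
    exact Finset.sum_congr rfl fun χ hχ => by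
      rw [Irr_apply_conj ((Irr_finite G).mem_toFinset.mp hχ)]
  · have hcoeff : ∀ χ ∈ (Irr_finite G).toFinset,
        ∑ x, (∑ z, f z * χ z⁻¹) * χ x * ψ x⁻¹ =
          if χ = ψ then (∑ z, f z * χ z⁻¹) * Nat.card G else 0 := fun χ hχ => by
      simp only [mul_assoc (∑ _, _)]
      rw [← Finset.mul_sum, sum_Irr_mul_Irr_inv ((Irr_finite G).mem_toFinset.mp hχ) hψ, mul_ite,
        mul_zero]
    simp only [sub_mul, Finset.sum_sub_distrib, Finset.sum_mul]
    rw [Finset.sum_comm]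
    simp only [← Finset.sum_mul]
    rw [Finset.sum_congr rfl hcoeff, Finset.sum_ite_eq',
      if_pos ((Irr_finite G).mem_toFinset.mpr hψ)]
    simp only [mul_assoc, ← Finset.mul_sum]
    ring

end ClassFunctions

variable [Finite G]

theorem card_conjClasses_le_ncard_Irr : Nat.card (ConjClasses G) ≤ (Irr G).ncard := by
  classical
  cases nonempty_fintype G
  let I := (Irr_finite G).toFinset
  let Φ : (I → ℂ) →ₗ[ℂ] (G → ℂ) := Fintype.linearCombination ℂ fun χ : I => (χ : G → ℂ)
  let Ψ : (ConjClasses G → ℂ) →ₗ[ℂ] (G → ℂ) := LinearMap.funLeft ℂ ℂ ConjClasses.mk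
  have hΨ : Function.Injective Ψ :=
    LinearMap.funLeft_injective_of_surjective ℂ ℂ _ ConjClasses.mk_surjective
  have hG : (Nat.card G : ℂ) ≠ 0 := by exact_mod_cast Nat.card_pos.ne'
  have hrange : LinearMap.range Ψ ≤ LinearMap.range Φ := by
    rintro _ ⟨f, rfl⟩
    have hcl (g x : G) : Ψ f (g * x * g⁻¹) = Ψ f x :=
      congrArg f (ConjClasses.mk_eq_mk_iff_isConj.mpr (isConj_iff.mpr ⟨g, rfl⟩).symm)
    refine ⟨fun χ => (Nat.card G : ℂ)⁻¹ * ∑ x, Ψ f x * (χ : G → ℂ) x⁻¹, ?_⟩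
    ext y
    rw [Fintype.linearCombination_apply, Finset.sum_apply]
    simp only [Pi.smul_apply, smul_eq_mul, mul_assoc]
    rw [← Finset.mul_sum, inv_mul_eq_iff_eq_mul₀ hG, card_mul_eq_sum_Irr hcl,
      ← Finset.sum_coe_sort I]
  have hfinrank := (Submodule.finrank_mono hrange).trans (LinearMap.finrank_range_le Φ)
  rw [LinearMap.finrank_range_of_inj hΨ, Module.finrank_fintype_fun_eq_card,
    Module.finrank_fintype_fun_eq_card] at hfinrank
  rw [Nat.card_eq_fintype_card, Set.ncard_eq_toFinset_card _ (Irr_finite G)]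
  simpa [I] using hfinrank

theorem ncard_conjugatesOf_mul_sum_Irr_norm_sq (g : G) :
    ((conjugatesOf g).ncard : ℝ) * ∑ χ ∈ (Irr_finite G).toFinset, ‖χ g‖ ^ 2 = Nat.card G := by
  classical
  cases nonempty_fintype G
  have horth := card_mul_eq_sum_Irr (f := fun x => if IsConj g x then 1 else 0) (fun a x => by
    have hx : IsConj x (a * x * a⁻¹) := isConj_iff.mpr ⟨a, rfl⟩
    exact if_congr ⟨fun h => h.trans hx.symm, fun h => h.trans hx⟩ rfl rfl) g
  rw [if_pos (IsConj.refl g), mul_one] at horth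
  have hclass : (conjugatesOf g).ncard = Finset.card {x | IsConj g x} := by
    rw [← Set.ncard_coe_finset]
    congr 1
    ext
    simp [conjugatesOf]
  have hcoeff (χ) (hχ : χ ∈ (Irr_finite G).toFinset) :
      ∑ x, (if IsConj g x then 1 else 0) * χ x⁻¹ =
        (conjugatesOf g).ncard * (starRingEnd ℂ) (χ g) := by
    have hχ := (Irr_finite G).mem_toFinset.mp hχ
    rw [hclass, ← nsmul_eq_mul, ← Finset.sum_const, Finset.sum_filter]
    refine Finset.sum_congr rfl fun x _ => ?_
    rw [ite_mul, one_mul, zero_mul]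
    refine if_ctx_congr Iff.rfl (fun hx => ?_) fun _ => rfl
    obtain ⟨a, rfl⟩ := isConj_iff.mp hx
    rw [Irr_apply_inv hχ, Irr_apply_conj hχ]
  apply Complex.ofReal_injective
  push_cast
  rw [horth, Finset.mul_sum]
  refine Finset.sum_congr rfl fun χ hχ => ?_
  rw [hcoeff χ hχ, mul_assoc, Complex.conj_mul']

end IrreducibleCharacters

section EigenspaceDivisibility

variable {G : Type*} [Group G]

theorem dvd_finrank_eigenspace {k V : Type*} [Field k] [AddCommGroup V] [Module k V]
    (ρ : Representation k G V) {b h x : G} (hh : Commute b h) (hx : Commute b x) {z : k} {p : ℕ}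
    (hz : IsPrimitiveRoot z p) (hhx : ρ h * ρ x = z • (ρ x * ρ h)) (μ : k) :
    p ∣ Module.finrank k (Module.End.eigenspace (ρ b) μ) := by
  have hmap (y : G) (hy : Commute b y) := mapsTo_eigenspace_of_commute (hy.map ρ) μ
  have hunit (y : G) (hy : Commute b y) : IsUnit ((ρ y).restrict (hmap y hy)) := by
    refine ⟨⟨_, (ρ y⁻¹).restrict (hmap y⁻¹ hy.inv_right), ?_, ?_⟩, rfl⟩ <;>
    · ext v
      simp [LinearMap.restrict_apply]
  refine dvd_finrank_of_mul_eq_smul_mul (hunit h hh) (hunit x hx) hz ?_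
  ext v
  simpa [LinearMap.restrict_apply] using LinearMap.congr_fun hhx (v : V)

theorem two_mul_totient_mul_totient_le_sum_norm_sq_character {V : Type*} [AddCommGroup V]
    [Module ℂ V] [FiniteDimensional ℂ V] (ρ : Representation ℂ G V) {p m n : ℕ} [Fact p.Prime]
    [NeZero n] {a b h x : G} (hab : Commute a b) (ha : a ^ p ^ (m + 1) = 1) (hb : b ^ n = 1)
    (hh : Commute b h) (hx : Commute b x) {z : ℂ} (hz : IsPrimitiveRoot z p)
    (hhx : ρ h * ρ x = z • (ρ x * ρ h)) {i₀ : (ZMod (p ^ (m + 1)))ˣ} {j₀ : (ZMod n)ˣ}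
    (h0 : ρ.character (a ^ (i₀ : ZMod (p ^ (m + 1))).val * b ^ (j₀ : ZMod n).val) ≠ 0) :
    2 * (p ^ (m + 1)).totient * (n.totient : ℝ) ≤
      ∑ i : (ZMod (p ^ (m + 1)))ˣ, ∑ j : (ZMod n)ˣ,
        ‖ρ.character (a ^ (i : ZMod (p ^ (m + 1))).val * b ^ (j : ZMod n).val)‖ ^ 2 := by
  have hchar (i j : ℕ) :
      ρ.character (a ^ i * b ^ j) = LinearMap.trace ℂ V (ρ b ^ j * ρ a ^ i) := by
    rw [Representation.character, (hab.pow_pow i j).eq, map_mul, map_pow, map_pow]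
  simp only [hchar] at h0 ⊢
  exact two_mul_totient_mul_totient_le_sum_norm_sq_trace (hab.map ρ)
    (by rw [← map_pow, ha, map_one]) (by rw [← map_pow, hb, map_one])
    (dvd_finrank_eigenspace ρ hh hx hz hhx) h0

end EigenspaceDivisibility

section ScalarSubgroup

variable {k G V : Type*} [Field k] [Group G] [AddCommGroup V] [Module k V]

/-- The elements of the group that a representation maps to scalars (for a character, its centre
`Z(χ)`). A lift of a central element of the quotient commutes up to scalars with every `ρ x`. -/
def scalarSubgroup (ρ : Representation k G V) : Subgroup G where
  carrier := {g | ∃ c : k, ρ g = c • 1}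
  one_mem' := ⟨1, by simp⟩
  mul_mem' := by
    rintro a b ⟨c, hc⟩ ⟨d, hd⟩
    exact ⟨c * d, by rw [map_mul, hc, hd, smul_mul_smul_comm, one_mul]⟩
  inv_mem' := by
    rintro a ⟨c, hc⟩
    have hinv : c • ρ a⁻¹ = 1 := by
      rw [← mul_one (ρ a⁻¹), ← mul_smul_comm, ← hc, ← map_mul, inv_mul_cancel, map_one]
    rcases eq_or_ne c 0 with rfl | h0
    · rw [zero_smul] at hinv
      exact ⟨0, by rw [← mul_one (ρ a⁻¹), ← hinv, mul_zero, smul_zero]⟩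
    · exact ⟨c⁻¹, by rw [← hinv, inv_smul_smul₀ h0]⟩

instance (ρ : Representation k G V) : (scalarSubgroup ρ).Normal where
  conj_mem := by
    rintro n ⟨c, hc⟩ g
    exact ⟨c, by
      rw [map_mul, map_mul, hc, mul_smul_comm, mul_one, smul_mul_assoc, ← map_mul,
        mul_inv_cancel, map_one]⟩

variable {ρ : Representation k G V}

theorem nontrivial_of_isIrreducible (hρ : ρ.IsIrreducible) : Nontrivial V := by
  rw [Representation.irreducible_iff_isSimpleModule_asModule] at hρ
  exact IsSimpleModule.nontrivial (MonoidAlgebra k G) ρ.asModule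

theorem scalarSubgroup_ne_top (hρ : ρ.IsIrreducible) (hV : Module.finrank k V ≠ 1) :
    scalarSubgroup ρ ≠ ⊤ := by
  intro htop
  have := nontrivial_of_isIrreducible hρ
  obtain ⟨v, hv⟩ := exists_ne (0 : V)
  let W : Subrepresentation ρ := ⟨Submodule.span k {v}, fun g w hw => by
    obtain ⟨c, hc⟩ : g ∈ scalarSubgroup ρ := htop ▸ Subgroup.mem_top g
    rw [hc]
    exact Submodule.smul_mem _ c hw⟩
  rcases hρ.eq_bot_or_eq_top W with h | h
  · exact hv (Submodule.span_singleton_eq_bot.mp (congrArg Subrepresentation.toSubmodule h))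
  · have hspan : Submodule.span k {v} = ⊤ := congrArg Subrepresentation.toSubmodule h
    exact hV (by rw [← finrank_top k V, ← hspan, finrank_span_singleton hv])

theorem exists_mul_eq_smul_mul_of_isNilpotent [IsAlgClosed k] [FiniteDimensional k V]
    [Group.IsNilpotent G] (hρ : ρ.IsIrreducible) (hV : Module.finrank k V ≠ 1) :
    ∃ (h x : G) (c : k), c ≠ 1 ∧ ρ h * ρ x = c • (ρ x * ρ h) := by
  have : Nontrivial (G ⧸ scalarSubgroup ρ) :=
    QuotientGroup.nontrivial_iff.mpr (scalarSubgroup_ne_top hρ hV)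
  obtain ⟨q, hq, hq1⟩ := (Subgroup.bot_or_exists_ne_one
    (Subgroup.center (G ⧸ scalarSubgroup ρ))).resolve_left (Group.IsNilpotent.center_ne_bot _)
  obtain ⟨h, rfl⟩ := QuotientGroup.mk_surjective q
  rw [ne_eq, QuotientGroup.eq_one_iff] at hq1
  obtain ⟨x, hx⟩ : ∃ x, ρ h * ρ x ≠ ρ x * ρ h := by
    by_contra! hc
    exact hq1 (exists_eq_smul_one_of_isIrreducible hρ hc)
  obtain ⟨c, hc⟩ : (x * h)⁻¹ * (h * x) ∈ scalarSubgroup ρ :=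
    QuotientGroup.eq.mp (Subgroup.mem_center_iff.mp hq x)
  have hmul : ρ h * ρ x = c • (ρ x * ρ h) := by
    rw [← map_mul, ← map_mul, ← mul_inv_cancel_left (x * h) (h * x), map_mul, hc, mul_smul_comm,
      mul_one]
  refine ⟨h, x, c, ?_, hmul⟩
  rintro rfl
  exact hx (by rw [hmul, one_smul])

end ScalarSubgroup

section PrimePower

theorem pow_mul_pow_eq_smul_pow_mul_pow {k A : Type*} [CommSemiring k] [Semiring A] [Algebra k A]
    {S T : A} {c : k} (hc : S * T = c • (T * S)) (m n : ℕ) :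
    S ^ m * T ^ n = c ^ (m * n) • (T ^ n * S ^ m) := by
  have hleft (m : ℕ) : S ^ m * T = c ^ m • (T * S ^ m) := by
    induction m with
    | zero => simp
    | succ m ih =>
      rw [pow_succ, mul_assoc, hc, mul_smul_comm, ← mul_assoc, ih, smul_mul_assoc, smul_smul,
        mul_assoc, pow_succ' c]
  induction n with
  | zero => simp
  | succ n ih =>
    rw [pow_succ, ← mul_assoc, ih, smul_mul_assoc, mul_assoc, hleft, mul_smul_comm, smul_smul,
      mul_assoc, mul_add, pow_add, mul_one]

variable {k G V : Type*} [Field k] [Group G] [AddCommGroup V] [Module k V]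
  {ρ : Representation k G V}

theorem pow_eq_one_of_mul_eq_smul_mul [Nontrivial V] {h x : G} {c : k}
    (hc : ρ h * ρ x = c • (ρ x * ρ h)) {n : ℕ} (hn : h ^ n = 1) : c ^ n = 1 := by
  have hpow := pow_mul_pow_eq_smul_pow_mul_pow hc n 1
  rw [← map_pow, hn, map_one, one_mul, mul_one, pow_one, mul_one] at hpow
  have hsmul : (c ^ n - 1) • (1 : Module.End k V) = 0 := by
    rw [sub_smul, one_smul, sub_eq_zero, ← map_one ρ, ← mul_inv_cancel x, map_mul,
      ← smul_mul_assoc, ← hpow]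
  exact sub_eq_zero.mp ((smul_eq_zero.mp hsmul).resolve_right one_ne_zero)

-- Suitable powers of `h` and `x` turn `c` into a root of unity of prime order `p`.
theorem exists_prime_mul_eq_smul_mul [Finite G] [Nontrivial V] {h x : G} {c : k} (hc1 : c ≠ 1)
    (hc : ρ h * ρ x = c • (ρ x * ρ h)) :
    ∃ (p m n : ℕ) (h x : G) (z : k), p.Prime ∧ Nat.card G = p ^ (m + 1) * n ∧ p.Coprime n ∧
      h ^ p ^ (m + 1) = 1 ∧ x ^ p ^ (m + 1) = 1 ∧ IsPrimitiveRoot z p ∧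
      ρ h * ρ x = z • (ρ x * ρ h) := by
  have hG : 0 < Nat.card G := Nat.card_pos
  have hdvd : orderOf c ∣ Nat.card G :=
    orderOf_dvd_of_pow_eq_one (pow_eq_one_of_mul_eq_smul_mul hc pow_card_eq_one')
  obtain ⟨p, hp, k, hk⟩ := Nat.exists_prime_and_dvd (mt orderOf_eq_one_iff.mp hc1)
  have hz : IsPrimitiveRoot (c ^ k) p :=
    (IsPrimitiveRoot.orderOf c).pow (Nat.pos_of_dvd_of_pos hdvd hG) (by rw [hk, mul_comm])
  obtain ⟨s, n, hn, hs⟩ := Nat.exists_eq_pow_mul_and_not_dvd hG.ne' p hp.ne_one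
  obtain ⟨m, rfl⟩ : ∃ m, s = m + 1 := Nat.exists_eq_succ_of_ne_zero fun h0 => hn <| by
    rw [h0, pow_zero, one_mul] at hs
    exact hs ▸ (Dvd.intro k hk.symm).trans hdvd
  have hcop : p.Coprime n := hp.coprime_iff_not_dvd.mpr hn
  refine ⟨p, m, n, h ^ n, x ^ (k * n), (c ^ k) ^ (n * n), hp, hs, hcop, ?_, ?_, ?_, ?_⟩
  · rw [← pow_mul, mul_comm n, ← hs, pow_card_eq_one']
  · rw [← pow_mul, mul_assoc, mul_comm n, ← hs, mul_comm, pow_mul, pow_card_eq_one', one_pow]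
  · exact hz.pow_of_coprime _ (hcop.symm.mul_left hcop.symm)
  · rw [map_pow, map_pow, pow_mul_pow_eq_smul_pow_mul_pow hc, ← pow_mul]
    congr 2
    ring

end PrimePower

section CoprimeParts

theorem commute_of_coprime_orderOf {G : Type*} [Group G] [Finite G] [Group.IsNilpotent G]
    {x y : G} (h : (orderOf x).Coprime (orderOf y)) : Commute x y := by
  obtain ⟨e⟩ := (Group.isNilpotent_of_finite_tfae (G := G)).out 0 4 |>.mp ‹_›
  refine (commute_map_iff e.symm.injective).mp (funext fun p => funext fun P => ?_)
  have : Fact (p : ℕ).Prime := ⟨Nat.prime_of_mem_primeFactors p.2⟩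
  have hdvd (z : G) : orderOf (e.symm z p P) ∣ orderOf z := by
    rw [← orderOf_injective e.symm.toMonoidHom e.symm.injective z]
    exact orderOf_dvd_of_pow_eq_one
      (congrFun (congrFun (pow_orderOf_eq_one (e.symm z)) p) P)
  have hcop := Nat.Coprime.of_dvd (hdvd x) (hdvd y) h
  obtain ⟨k, hk⟩ := IsPGroup.iff_orderOf.mp P.isPGroup' (e.symm x p P)
  obtain ⟨l, hl⟩ := IsPGroup.iff_orderOf.mp P.isPGroup' (e.symm y p P)
  rcases k.eq_zero_or_pos with rfl | hk0
  · rw [pow_zero, orderOf_eq_one_iff] at hk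
    simp [hk]
  rcases l.eq_zero_or_pos with rfl | hl0
  · rw [pow_zero, orderOf_eq_one_iff] at hl
    simp [hl]
  rw [hk, hl, Nat.coprime_pow_left_iff hk0, Nat.coprime_pow_right_iff hl0,
    Nat.coprime_self] at hcop
  exact absurd hcop this.out.ne_one

variable {M : Type*} [Monoid M] {q n : ℕ}

theorem exists_commute_mul_eq_of_coprime {g : M} (hqn : q.Coprime n)
    (hg : g ^ (q * n) = 1) : ∃ a b : M, Commute a b ∧ a * b = g ∧ a ^ q = 1 ∧ b ^ n = 1 := by
  obtain ⟨k, hk1, hk0⟩ := Nat.chineseRemainder hqn 1 0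
  obtain ⟨l, hl0, hl1⟩ := Nat.chineseRemainder hqn 0 1
  refine ⟨g ^ k, g ^ l, (Commute.refl g).pow_pow k l, ?_, ?_, ?_⟩
  · have hkl : k + l ≡ 1 [MOD q * n] :=
      (Nat.modEq_and_modEq_iff_modEq_mul hqn).mp ⟨hk1.add hl0, hk0.add hl1⟩
    rw [← pow_add, pow_eq_pow_mod _ hg, hkl, ← pow_eq_pow_mod _ hg, pow_one]
  · obtain ⟨d, rfl⟩ := Nat.modEq_zero_iff_dvd.mp hk0
    rw [← pow_mul, show n * d * q = q * n * d by ring, pow_mul, hg, one_pow]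
  · obtain ⟨d, rfl⟩ := Nat.modEq_zero_iff_dvd.mp hl0
    rw [← pow_mul, show q * d * n = q * n * d by ring, pow_mul, hg, one_pow]

theorem sum_zmod_units_mul_pow_eq_sum_sum {A : Type*} [AddCommMonoid A] {a b : M}
    (hab : Commute a b) [NeZero q] [NeZero n] {N : ℕ} [NeZero N] (hN : N = q * n)
    (hqn : q.Coprime n) (ha : a ^ q = 1) (hb : b ^ n = 1) (f : M → A) :
    ∑ k : (ZMod N)ˣ, f ((a * b) ^ (k : ZMod N).val) =
      ∑ i : (ZMod q)ˣ, ∑ j : (ZMod n)ˣ, f (a ^ (i : ZMod q).val * b ^ (j : ZMod n).val) := by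
  subst hN
  let e := ZMod.chineseRemainder hqn
  let E : (ZMod (q * n))ˣ ≃* (ZMod q)ˣ × (ZMod n)ˣ :=
    (Units.mapEquiv e.toMulEquiv).trans MulEquiv.prodUnits
  rw [← Fintype.sum_prod_type', ← E.toEquiv.sum_comp]
  refine Finset.sum_congr rfl fun k _ => ?_
  have hval : e k = ((k : ZMod (q * n)).val : ZMod q × ZMod n) := by
    rw [← map_natCast e, ZMod.natCast_zmod_val]
  have hfst : ((E k).1 : ZMod q) = ((k : ZMod (q * n)).val : ZMod q) := congrArg Prod.fst hval
  have hsnd : ((E k).2 : ZMod n) = ((k : ZMod (q * n)).val : ZMod n) := congrArg Prod.snd hval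
  simp only [MulEquiv.toEquiv_eq_coe, EquivLike.coe_coe, hfst, hsnd, ZMod.val_natCast]
  rw [hab.mul_pow, ← pow_eq_pow_mod _ ha, ← pow_eq_pow_mod _ hb]

end CoprimeParts

section NilpotentGroup

variable {G : Type*} [Group G]

theorem ncard_conjugatesOf_pow (g : G) {k : ℕ} (hk : k.Coprime (Nat.card G)) :
    (conjugatesOf (g ^ k)).ncard = (conjugatesOf g).ncard := by
  have himage : conjugatesOf (g ^ k) = (fun x => x ^ k) '' conjugatesOf g := by
    ext y
    simp only [conjugatesOf, Set.mem_ofPred_eq, Set.mem_image, isConj_iff]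
    constructor
    · rintro ⟨c, rfl⟩
      exact ⟨c * g * c⁻¹, ⟨c, rfl⟩, conj_pow⟩
    · rintro ⟨_, ⟨c, rfl⟩, rfl⟩
      exact ⟨c, conj_pow.symm⟩
  rw [himage]
  exact Set.ncard_image_of_injective _ (powCoprime hk.symm).injective

variable [Finite G]

theorem norm_eq_one_of_mem_Irr_of_apply_one {χ : G → ℂ} (hχ : χ ∈ Irr G) (h1 : χ 1 = 1) (g : G) :
    ‖χ g‖ = 1 := by
  obtain ⟨V, _, _, _, ρ, -, rfl⟩ := hχ
  rw [ρ.char_one] at h1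
  have hV : Module.finrank ℂ V = 1 := by exact_mod_cast h1
  have hdet : ρ.character g = LinearMap.det (ρ g) := by
    obtain ⟨c, hc⟩ := (LinearMap.existsUnique_eq_smul_id_of_finrank_eq_one hV (ρ g)).exists
    simp [Representation.character, hc, hV]
  refine Complex.norm_eq_one_of_pow_eq_one (n := Nat.card G) ?_ Nat.card_pos.ne'
  rw [hdet, ← map_pow, ← map_pow, pow_card_eq_one', map_one, map_one]

theorem ncard_conjugatesOf_mul_sum_sum_Irr_norm_sq (g : G) :
    ((conjugatesOf g).ncard : ℝ) * ∑ χ ∈ (Irr_finite G).toFinset,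
      ∑ k : (ZMod (Nat.card G))ˣ, ‖χ (g ^ (k : ZMod (Nat.card G)).val)‖ ^ 2 =
      (Nat.card G).totient * Nat.card G := by
  rw [Finset.sum_comm, Finset.mul_sum, Finset.sum_congr rfl fun k _ => by
    rw [← ncard_conjugatesOf_pow g (ZMod.val_coe_unit_coprime k),
      ncard_conjugatesOf_mul_sum_Irr_norm_sq]]
  simp [ZMod.card_units_eq_totient]

variable [Group.IsNilpotent G]

theorem two_mul_totient_le_sum_norm_sq {χ : G → ℂ} (hχ : χ ∈ nonlinearIrr G) {g : G}
    (hg : χ g ≠ 0) : 2 * ((Nat.card G).totient : ℝ) ≤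
      ∑ k : (ZMod (Nat.card G))ˣ, ‖χ (g ^ (k : ZMod (Nat.card G)).val)‖ ^ 2 := by
  obtain ⟨⟨V, _, _, _, ρ, hρ, rfl⟩, h1⟩ := hχ
  have hV : Module.finrank ℂ V ≠ 1 := fun h => h1 (by rw [ρ.char_one, h, Nat.cast_one])
  have := nontrivial_of_isIrreducible hρ
  obtain ⟨_, _, c, hc1, hc⟩ := exists_mul_eq_smul_mul_of_isNilpotent hρ hV
  obtain ⟨p, m, n, h, x, z, hp, hN, hpn, hh, hx, hz, hhx⟩ := exists_prime_mul_eq_smul_mul hc1 hc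
  have hqn : (p ^ (m + 1)).Coprime n := hpn.pow_left _
  have : Fact p.Prime := ⟨hp⟩
  have : NeZero n := ⟨fun h0 => NeZero.ne (Nat.card G) (by rw [hN, h0, mul_zero])⟩
  obtain ⟨a, b, hab, rfl, ha, hb⟩ := exists_commute_mul_eq_of_coprime (g := g) hqn
    (by rw [← hN, pow_card_eq_one'])
  have hcomm (y : G) (hy : y ^ p ^ (m + 1) = 1) : Commute b y :=
    commute_of_coprime_orderOf (Nat.Coprime.of_dvd (orderOf_dvd_of_pow_eq_one hb)
      (orderOf_dvd_of_pow_eq_one hy) hqn.symm)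
  rw [sum_zmod_units_mul_pow_eq_sum_sum hab hN hqn ha hb fun y => ‖ρ.character y‖ ^ 2, hN,
    Nat.totient_mul hqn, Nat.cast_mul, ← mul_assoc]
  refine two_mul_totient_mul_totient_le_sum_norm_sq_character ρ hab ha hb (hcomm h hh)
    (hcomm x hx) hz hhx (i₀ := 1) (j₀ := 1) ?_
  rwa [Units.val_one, Units.val_one, ZMod.val_one_eq_one_mod, ZMod.val_one_eq_one_mod,
    ← pow_eq_pow_mod _ ha, ← pow_eq_pow_mod _ hb, pow_one, pow_one]

theorem totient_mul_le_sum_sum_Irr_norm_sq (g : G) :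
    ((Nat.card G).totient : ℝ) * (2 * {χ ∈ nonlinearIrr G | χ g ≠ 0}.ncard +
      {χ ∈ Irr G | χ 1 = 1}.ncard) ≤ ∑ χ ∈ (Irr_finite G).toFinset,
        ∑ k : (ZMod (Nat.card G))ˣ, ‖χ (g ^ (k : ZMod (Nat.card G)).val)‖ ^ 2 := by
  classical
  have hM : {χ ∈ nonlinearIrr G | χ g ≠ 0}.Finite := (Irr_finite G).subset fun χ hχ => hχ.1.1
  have hL : {χ ∈ Irr G | χ 1 = 1}.Finite := (Irr_finite G).subset fun χ hχ => hχ.1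
  have hdisj : Disjoint hM.toFinset hL.toFinset := by
    rw [Set.Finite.disjoint_toFinset]
    exact Set.disjoint_left.mpr fun χ hχ hχ' => hχ.1.2 hχ'.2
  have hsub : hM.toFinset ∪ hL.toFinset ⊆ (Irr_finite G).toFinset :=
    Finset.union_subset (Set.Finite.toFinset_mono fun χ hχ => hχ.1.1)
      (Set.Finite.toFinset_mono fun χ hχ => hχ.1)
  refine le_trans ?_ (Finset.sum_le_sum_of_subset_of_nonneg hsub fun _ _ _ => by positivity)
  have hM_le := Finset.card_nsmul_le_sum hM.toFinset _ _ fun χ hχ =>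
    two_mul_totient_le_sum_norm_sq (hM.mem_toFinset.mp hχ).1 (hM.mem_toFinset.mp hχ).2
  have hL_eq : ∑ χ ∈ hL.toFinset, ∑ k : (ZMod (Nat.card G))ˣ,
      ‖χ (g ^ (k : ZMod (Nat.card G)).val)‖ ^ 2 = hL.toFinset.card * (Nat.card G).totient := by
    rw [← nsmul_eq_mul]
    refine Finset.sum_eq_card_nsmul fun χ hχ => ?_
    have hnorm := norm_eq_one_of_mem_Irr_of_apply_one (hL.mem_toFinset.mp hχ).1
      (hL.mem_toFinset.mp hχ).2
    simp [hnorm, ZMod.card_units_eq_totient]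
  rw [nsmul_eq_mul] at hM_le
  rw [Finset.sum_union hdisj, hL_eq, Set.ncard_eq_toFinset_card _ hM,
    Set.ncard_eq_toFinset_card _ hL]
  linarith

theorem two_mul_ncard_nonvanishing_add_ncard_linear_le (g : G) :
    (conjugatesOf g).ncard * (2 * {χ ∈ nonlinearIrr G | χ g ≠ 0}.ncard +
      {χ ∈ Irr G | χ 1 = 1}.ncard) ≤ Nat.card G := by
  have htot : (0 : ℝ) < (Nat.card G).totient := by
    exact_mod_cast Nat.totient_pos.mpr Nat.card_pos
  have hle := mul_le_mul_of_nonneg_left (totient_mul_le_sum_sum_Irr_norm_sq g)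
    (Nat.cast_nonneg (conjugatesOf g).ncard)
  rw [ncard_conjugatesOf_mul_sum_sum_Irr_norm_sq, mul_left_comm] at hle
  exact_mod_cast le_of_mul_le_mul_left hle htot

end NilpotentGroup

theorem ncard_sep_add_ncard_sep_not {α : Type*} {s : Set α} (hs : s.Finite) (p : α → Prop) :
    {x ∈ s | p x}.ncard + {x ∈ s | ¬ p x}.ncard = s.ncard :=
  Set.ncard_inter_add_ncard_sdiff_eq_ncard s {x | p x} hs

theorem theorem2 (G : Type*) [Group G] [Finite G] [Group.IsNilpotent G] (g : G) :
    (((conjugatesOf g).ncard : ℚ) > (Nat.card G : ℚ) / (Nat.card (ConjClasses G) : ℚ) →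
      ({χ ∈ nonlinearIrr G | χ g = 0}.ncard : ℚ) > ((nonlinearIrr G).ncard : ℚ) / 2) ∧
    (((conjugatesOf g).ncard : ℚ) = (Nat.card G : ℚ) / (Nat.card (ConjClasses G) : ℚ) →
      ({χ ∈ nonlinearIrr G | χ g = 0}.ncard : ℚ) ≥ ((nonlinearIrr G).ncard : ℚ) / 2) := by
  have hzero : {χ ∈ nonlinearIrr G | χ g = 0}.ncard + {χ ∈ nonlinearIrr G | χ g ≠ 0}.ncard =
      (nonlinearIrr G).ncard :=
    ncard_sep_add_ncard_sep_not ((Irr_finite G).subset fun χ hχ => hχ.1) fun χ => χ g = 0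
  have hlinear : {χ ∈ Irr G | χ 1 = 1}.ncard + (nonlinearIrr G).ncard = (Irr G).ncard :=
    ncard_sep_add_ncard_sep_not (Irr_finite G) fun χ => χ 1 = 1
  have hbound := two_mul_ncard_nonvanishing_add_ncard_linear_le g
  have hclasses := card_conjClasses_le_ncard_Irr (G := G)
  have hk : (0 : ℚ) < Nat.card (ConjClasses G) := by exact_mod_cast Nat.card_pos
  have hc : 0 < (conjugatesOf g).ncard := (Set.ncard_pos).mpr ⟨g, mem_conjugatesOf_self⟩
  rw [gt_iff_lt, gt_iff_lt, ge_iff_le, div_lt_iff₀ hk, div_lt_iff₀ two_pos, eq_div_iff hk.ne',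
    div_le_iff₀ two_pos]
  norm_cast
  constructor <;> intro h
  · have := Nat.lt_of_mul_lt_mul_left (hbound.trans_lt h)
    omega
  · have := Nat.le_of_mul_le_mul_left (hbound.trans h.ge) hc
    omega
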